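/- Let $v_1=(0,0)$, $v_2=(1,0)$, $v_3=\bigl(\tfrac12,\tfrac{\sqrt3}{2}\bigr)$ in $\mathbb{R}^2$, let $\phi_i(x)=\frac{x+v_i}{2}$ for $i=1,2,3$, and let $E$ be the standard Sierpiński triangle of side length $1$, i.e. the unique nonempty compact set $E\subset\mathbb{R}^2$ with $E=\phi_1(E)\cup\phi_2(E)\cup\phi_3(E)$. For an integer $n\ge 1$ let $$nE=\underbrace{E+\cdots+E}_{n\text{ times}}=\{a_1+\cdots+a_n : a_1,\dots,a_n\in E\}$$ be its $n$-fold Minkowski sumset. If $$n>\frac{\sqrt2}{\bigl(\sqrt{1+\sqrt3/6}-1\bigr)^2}\approx 77.37$$ (the value being correct to two decimals, i.e. with error less than $0.005$), then $nE$ has nonempty interior. In particular, $nE$ has nonempty interior for every integer $n\ge 78$. -/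

import Mathlib

open scoped Pointwise

noncomputable section

/-- The Euclidean plane. -/
abbrev Plane : Type := EuclideanSpace ℝ (Fin 2)

/-- The vertices `(0, 0)`, `(1, 0)`, `(1/2, √3/2)` of the unit equilateral triangle. -/
def vertex : Fin 3 → Plane :=
  ![!₂[0, 0], !₂[1, 0], !₂[1 / 2, Real.sqrt 3 / 2]]

/-- The corner map `φᵢ(x) = (x + vᵢ) / 2`. -/
def cornerMap (i : Fin 3) (x : Plane) : Plane := (1 / 2 : ℝ) • (x + vertex i)

/-- `E` is nonempty, compact, and `E = φ₁(E) ∪ φ₂(E) ∪ φ₃(E)`. -/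
def IsSierpinski (E : Set Plane) : Prop :=
  E.Nonempty ∧ IsCompact E ∧ E = ⋃ i, cornerMap i '' E

lemma dist_cornerMap (i : Fin 3) (x y : Plane) :
    dist (cornerMap i x) (cornerMap i y) = dist x y / 2 := by
  unfold cornerMap
  rw [dist_smul₀, dist_add_right, Real.norm_of_nonneg (by norm_num)]
  ring

lemma cornerMap_injective (i : Fin 3) : Function.Injective (cornerMap i) := by
  intro x y h
  have h1 := dist_cornerMap i x y
  rw [h, dist_self] at h1
  exact dist_eq_zero.1 (by linarith)

lemma continuous_cornerMap (i : Fin 3) : Continuous (cornerMap i) := by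
  unfold cornerMap
  fun_prop

lemma IsSierpinski.subset {E F : Set Plane} (hE : IsSierpinski E) (hF : IsSierpinski F) :
    E ⊆ F := by
  obtain ⟨x, hx, hmax⟩ := hE.2.1.exists_isMaxOn hE.1
    (Metric.continuous_infDist_pt F).continuousOn
  have hx' := hx
  rw [hE.2.2] at hx'
  obtain ⟨i, z, hz, rfl⟩ := Set.mem_iUnion.1 hx'
  obtain ⟨y, hy, hzy⟩ := hF.2.1.exists_infDist_eq_dist hF.1 z
  have hyF : cornerMap i y ∈ F := by
    rw [hF.2.2]
    exact Set.mem_iUnion.2 ⟨i, y, hy, rfl⟩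
  have h1 := Metric.infDist_le_dist_of_mem (x := cornerMap i z) hyF
  have h2 : Metric.infDist z F ≤ Metric.infDist (cornerMap i z) F := hmax hz
  rw [dist_cornerMap] at h1
  intro w hw
  have h3 : Metric.infDist w F ≤ Metric.infDist (cornerMap i z) F := hmax hw
  have h4 := Metric.infDist_nonneg (x := w) (s := F)
  rw [hF.2.1.isClosed.mem_iff_infDist_zero hF.1]
  linarith

lemma exists_isSierpinski : ∃ E : Set Plane, IsSierpinski E := by
  let Φ : Set Plane → Set Plane := fun K => ⋃ i, cornerMap i '' K
  have hmono : Monotone Φ := fun A B h => Set.iUnion_mono fun i => Set.image_mono h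
  let Δ : Set Plane := convexHull ℝ (Set.range vertex)
  let K : ℕ → Set Plane := fun m => Φ^[m] Δ
  have hK : ∀ m, K (m + 1) = Φ (K m) := fun m => Function.iterate_succ_apply' Φ m Δ
  have h0 : Φ Δ ⊆ Δ := by
    refine Set.iUnion_subset fun i => ?_
    rintro _ ⟨x, hx, rfl⟩
    have := (convex_convexHull ℝ (Set.range vertex)) hx
      (subset_convexHull ℝ _ (Set.mem_range_self i))
      (by norm_num : (0 : ℝ) ≤ 1 / 2) (by norm_num : (0 : ℝ) ≤ 1 / 2) (by norm_num)
    rw [← smul_add] at this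
    exact this
  have hstep : ∀ m, K (m + 1) ⊆ K m := by
    intro m
    induction m with
    | zero => exact h0
    | succ m ih =>
      have h := hmono ih
      rwa [← hK m, ← hK (m + 1)] at h
  have hanti : Antitone K := antitone_nat_of_succ_le hstep
  have hcpt : ∀ m, IsCompact (K m) := by
    intro m
    induction m with
    | zero => exact (Set.finite_range vertex).isCompact_convexHull ℝ
    | succ m ih =>
      rw [hK m]
      exact isCompact_iUnion fun i => ih.image (continuous_cornerMap i)
  have hne : ∀ m, (K m).Nonempty := by
    intro m
    induction m with
    | zero => exact ⟨_, subset_convexHull ℝ _ (Set.mem_range_self 0)⟩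
    | succ m ih =>
      rw [hK m]
      exact Set.nonempty_iUnion.2 ⟨0, ih.image _⟩
  refine ⟨⋂ m, K m, ?_, ?_, ?_⟩
  · exact IsCompact.nonempty_iInter_of_sequence_nonempty_isCompact_isClosed K hstep hne
      (hcpt 0) fun m => (hcpt m).isClosed
  · exact (hcpt 0).of_isClosed_subset (isClosed_iInter fun m => (hcpt m).isClosed)
      (Set.iInter_subset K 0)
  · apply Set.Subset.antisymm
    · intro x hx
      have hx' : ∀ m, ∃ i, x ∈ cornerMap i '' K m := by
        intro m
        have := Set.mem_iInter.1 hx (m + 1)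
        rw [hK m] at this
        exact Set.mem_iUnion.1 this
      by_contra hcon
      have hcon' : ∀ i, ∃ m, x ∉ cornerMap i '' K m := by
        intro i
        by_contra! h
        apply hcon
        refine Set.mem_iUnion.2 ⟨i, ?_⟩
        rw [(cornerMap_injective i).injOn.image_iInter_eq]
        exact Set.mem_iInter.2 h
      choose g hg using hcon'
      obtain ⟨i, hi⟩ := hx' (Finset.univ.sup g)
      exact hg i (Set.image_mono (hanti (Finset.le_sup (Finset.mem_univ i))) hi)
    · refine Set.subset_iInter fun m => ?_
      refine subset_trans ?_ (hstep m)
      rw [hK m]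
      exact hmono (Set.iInter_subset K m)

theorem existsUnique_isSierpinski : ∃! E : Set Plane, IsSierpinski E := by
  obtain ⟨E, hE⟩ := exists_isSierpinski
  exact ⟨E, hE, fun F hF => (hF.subset hE).antisymm (hE.subset hF)⟩

/-- The standard Sierpiński triangle of side length `1`: the unique nonempty compact set `E` with
`E = φ₁(E) ∪ φ₂(E) ∪ φ₃(E)`. -/
def sierpinskiTriangle : Set Plane := existsUnique_isSierpinski.choose

theorem sierpinskiTriangle_spec : IsSierpinski sierpinskiTriangle :=
  existsUnique_isSierpinski.choose_spec.1

end

/-- The `n`-fold sumset `A + ⋯ + A` (pointwise, i.e. Minkowski, addition of sets). This is not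
the dilate `{n a : a ∈ A}`. -/
def nfoldSumset (n : ℕ) (A : Set Plane) : Set Plane := ∑ _i : Fin n, A

theorem mem_nfoldSumset (n : ℕ) (A : Set Plane) (x : Plane) :
    x ∈ nfoldSumset n A ↔ ∃ f : Fin n → Plane, (∀ i, f i ∈ A) ∧ ∑ i, f i = x := by
  unfold nfoldSumset
  rw [Set.mem_fintype_sum]
  simp

/-! The triangle contains the two sides issuing from the origin
(`smul_vertex_mem_sierpinskiTriangle`). These point in independent directions, so their sum is a
solid parallelogram, and since `0 ∈ E` it stays inside every `n`-fold sumset with `n ≥ 2`. The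
threshold near 77.37 thus enters only through being larger than 2; its decimal value is a separate
computation. -/

/-- A nonempty compact set covered by its own corner copies lies in the Sierpiński triangle. -/
lemma subset_of_subset_iUnion_cornerMap {K F : Set Plane} (hne : K.Nonempty) (hK : IsCompact K)
    (hcov : K ⊆ ⋃ i, cornerMap i '' K) (hF : IsSierpinski F) : K ⊆ F := by
  obtain ⟨x, hx, hmax⟩ := hK.exists_isMaxOn hne (Metric.continuous_infDist_pt F).continuousOn
  obtain ⟨i, z, hz, rfl⟩ := Set.mem_iUnion.1 (hcov hx)
  obtain ⟨y, hy, hzy⟩ := hF.2.1.exists_infDist_eq_dist hF.1 z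
  have hyF : cornerMap i y ∈ F := by
    rw [hF.2.2]
    exact Set.mem_iUnion.2 ⟨i, y, hy, rfl⟩
  have h1 := Metric.infDist_le_dist_of_mem (x := cornerMap i z) hyF
  have h2 : Metric.infDist z F ≤ Metric.infDist (cornerMap i z) F := hmax hz
  -- The maximal distance `M` from `K` to `F` satisfies `M ≤ dist z y / 2 = infDist z F / 2 ≤ M /
  -- 2`, so `M = 0`.
  rw [dist_cornerMap] at h1
  intro w hw
  have h3 : Metric.infDist w F ≤ Metric.infDist (cornerMap i z) F := hmax hw
  have h4 := Metric.infDist_nonneg (x := w) (s := F)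
  rw [hF.2.1.isClosed.mem_iff_infDist_zero hF.1]
  linarith

lemma vertex_zero : vertex 0 = 0 := by
  ext i
  fin_cases i <;> simp [vertex]

/-- The sides of the triangle through the origin lie in the Sierpiński triangle. -/
lemma smul_vertex_mem_sierpinskiTriangle (j : Fin 3) {t : ℝ} (ht : t ∈ Set.Icc (0 : ℝ) 1) :
    t • vertex j ∈ sierpinskiTriangle := by
  refine subset_of_subset_iUnion_cornerMap (K := (fun s : ℝ => s • vertex j) '' Set.Icc 0 1)
    (Set.Nonempty.image _ ⟨0, by simp⟩) (isCompact_Icc.image (by fun_prop)) ?_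
    sierpinskiTriangle_spec ⟨t, ht, rfl⟩
  rintro _ ⟨s, ⟨hs0, hs1⟩, rfl⟩
  -- The side is the union of its two halves, its images under `cornerMap 0` (halving, as `vertex 0
  -- = 0`) and `cornerMap j`.
  rcases le_total s (1 / 2) with h | h
  · refine Set.mem_iUnion.2 ⟨0, _, ⟨2 * s, ⟨by linarith, by linarith⟩, rfl⟩, ?_⟩
    simp only [cornerMap, vertex_zero]
    module
  · refine Set.mem_iUnion.2 ⟨j, _, ⟨2 * s - 1, ⟨by linarith, by linarith⟩, rfl⟩, ?_⟩
    simp only [cornerMap]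
    module

lemma add_mem_nfoldSumset {A : Set Plane} (h0 : (0 : Plane) ∈ A) {x y : Plane} (hx : x ∈ A)
    (hy : y ∈ A) {n : ℕ} (hn : 2 ≤ n) : x + y ∈ nfoldSumset n A := by
  obtain ⟨m, rfl⟩ := Nat.exists_eq_add_of_le' hn
  rw [mem_nfoldSumset]
  -- The remaining `m` summands are zero.
  refine ⟨Fin.cons x (Fin.cons y fun _ => 0), fun i => ?_, by simp [Fin.sum_univ_succ]⟩
  refine Fin.cases hx (fun i => ?_) i
  exact Fin.cases hy (fun _ => h0) i

/-- Already the twofold sumset of the Sierpiński triangle contains a parallelogram. -/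
theorem interior_nfoldSumset_sierpinskiTriangle_nonempty {n : ℕ} (hn : 2 ≤ n) :
    (interior (nfoldSumset n sierpinskiTriangle)).Nonempty := by
  -- `f` and `g` are the coordinates in the basis `vertex 1`, `vertex 2`.
  let f : Plane → ℝ := fun x => x 0 - x 1 / Real.sqrt 3
  let g : Plane → ℝ := fun x => 2 * x 1 / Real.sqrt 3
  have h3 : Real.sqrt 3 ≠ 0 := by positivity
  have hopen : IsOpen (f ⁻¹' Set.Ioo 0 1 ∩ g ⁻¹' Set.Ioo 0 1) :=
    (isOpen_Ioo.preimage (by fun_prop)).inter (isOpen_Ioo.preimage (by fun_prop))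
  refine Set.Nonempty.mono (interior_maximal ?_ hopen)
    -- The centre of the parallelogram, where both coordinates are `1 / 2`.
    ⟨!₂[3 / 4, Real.sqrt 3 / 4], ?_, ?_⟩
  · rintro x ⟨hf, hg⟩
    have hx : x = f x • vertex 1 + g x • vertex 2 := by
      ext i
      fin_cases i
      · simp [f, g, vertex]
        ring
      · simp [f, g, vertex]
        field_simp
    rw [hx]
    have h0 := smul_vertex_mem_sierpinskiTriangle 0 (t := 0) (by simp)
    rw [zero_smul] at h0
    exact add_mem_nfoldSumset h0
      (smul_vertex_mem_sierpinskiTriangle 1 (Set.Ioo_subset_Icc_self hf))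
      (smul_vertex_mem_sierpinskiTriangle 2 (Set.Ioo_subset_Icc_self hg)) hn
  · have : f !₂[3 / 4, Real.sqrt 3 / 4] = 1 / 2 := by
      simp [f]
      field_simp
      norm_num
    rw [Set.mem_preimage, this]
    norm_num
  · have : g !₂[3 / 4, Real.sqrt 3 / 4] = 1 / 2 := by
      simp [g]
      field_simp
      norm_num
    rw [Set.mem_preimage, this]
    norm_num

/-- Dividing by the square of `s - 1 ≈ 0.135` magnifies errors; bounds on the roots to about seven
digits still locate the quotient to within `0.001`. -/
lemma abs_sqrt_two_div_sub_lt :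
    |Real.sqrt 2 / (Real.sqrt (1 + Real.sqrt 3 / 6) - 1) ^ 2 - 77.37| < 0.005 := by
  have h3 : 1.7320508 < Real.sqrt 3 := Real.lt_sqrt_of_sq_lt (by norm_num)
  have h3' : Real.sqrt 3 < 1.7320509 := (Real.sqrt_lt' (by norm_num)).2 (by norm_num)
  have h2 : 1.4142135 < Real.sqrt 2 := Real.lt_sqrt_of_sq_lt (by norm_num)
  have h2' : Real.sqrt 2 < 1.4142136 := (Real.sqrt_lt' (by norm_num)).2 (by norm_num)
  have hs : 1.1351982 < Real.sqrt (1 + Real.sqrt 3 / 6) :=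
    Real.lt_sqrt_of_sq_lt (by norm_num at h3 ⊢; linarith)
  have hs' : Real.sqrt (1 + Real.sqrt 3 / 6) < 1.1351984 :=
    (Real.sqrt_lt' (by norm_num)).2 (by norm_num at h3' ⊢; linarith)
  set s := Real.sqrt (1 + Real.sqrt 3 / 6)
  have hlo : (0.1351982 : ℝ) ^ 2 < (s - 1) ^ 2 :=
    pow_lt_pow_left₀ (by norm_num at hs ⊢; linarith) (by norm_num) (by norm_num)
  have hhi : (s - 1) ^ 2 < (0.1351984 : ℝ) ^ 2 :=
    pow_lt_pow_left₀ (by norm_num at hs' ⊢; linarith) (by norm_num at hs ⊢; linarith)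
      (by norm_num)
  have hpos : 0 < (s - 1) ^ 2 := lt_trans (by norm_num) hlo
  have hlt : Real.sqrt 2 / (s - 1) ^ 2 < 77.375 := by
    rw [div_lt_iff₀ hpos]
    norm_num at hlo h2' ⊢
    linarith
  have hgt : 77.365 < Real.sqrt 2 / (s - 1) ^ 2 := by
    rw [lt_div_iff₀ hpos]
    norm_num at hhi h2 ⊢
    linarith
  rw [abs_lt]
  norm_num at hlt hgt ⊢
  constructor <;> linarith

theorem corollary5p1 :
    (∀ n : ℕ, Real.sqrt 2 / (Real.sqrt (1 + Real.sqrt 3 / 6) - 1) ^ 2 < (n : ℝ) →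
      (interior (nfoldSumset n sierpinskiTriangle)).Nonempty) ∧
    |Real.sqrt 2 / (Real.sqrt (1 + Real.sqrt 3 / 6) - 1) ^ 2 - 77.37| < 0.005 ∧
    (∀ n : ℕ, 78 ≤ n → (interior (nfoldSumset n sierpinskiTriangle)).Nonempty) := by
  refine ⟨fun n hn => interior_nfoldSumset_sierpinskiTriangle_nonempty ?_,
    abs_sqrt_two_div_sub_lt,
    fun n hn => interior_nfoldSumset_sierpinskiTriangle_nonempty (by omega)⟩
  have h := (abs_lt.1 abs_sqrt_two_div_sub_lt).1
  have h2 : (2 : ℝ) < n := by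
    norm_num at h
    linarith
  exact_mod_cast h2.le
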